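/- Theorem (Salce's Lemma). Let $(\mathcal A;\mathcal E)$ be an exact category, that is, an additive category $\mathcal A$ with a Quillen exact structure $\mathcal E$ (a class of kernel-cokernel pairs, called conflations, $A\to B\to C$ with inflation $A\to B$ and deflation $B\to C$). Definitions. An ideal of $\mathcal A$ is a class $\mathcal I$ of morphisms such that each $\mathcal I(A,B)=\mathcal I\cap\operatorname{Hom}(A,B)$ is a subgroup of $\operatorname{Hom}(A,B)$, and such that $fgh\in\mathcal I$ whenever $g\in\mathcal I$ and the composite is defined. Given arrows $i:I_0\to I_1$ and $j:J_0\to J_1$, an ME-extension of $j$ by $i$ is a morphism $(i,a,j)$ from a conflation $I_0\to A_0\xrightarrow{e_0}J_0$ to a conflation $I_1\xrightarrow{m_1}A_1\to J_1$ that factors as a morphism $(1_{I_0},a^1,j)$ to a conflation $I_0\to A\to J_1$ followed by a morphism $(i,a^2,1_{J_1})$; it is null-homotopic if $a=m_1h+ge_0$ for some $h:A_0\to I_1$ and $g:J_0\to A_1$. Write $\operatorname{Ext}(j,i)=0$ if every ME-extension of $j$ by $i$ is null-homotopic. For a class $\mathcal I$ of morphisms put $\mathcal I^{\perp}=\{j\mid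 \operatorname{Ext}(i,j)=0\text{ for all }i\in\mathcal I\}$ and ${}^{\perp}\mathcal I=\{j\mid \operatorname{Ext}(j,i)=0\text{ for all }i\in\mathcal I\}$. A morphism is injective if it lies in $\operatorname{Hom}^{\perp}$ and projective if it lies in ${}^{\perp}\operatorname{Hom}$, where $\operatorname{Hom}$ is the ideal of all morphisms. There are enough injective morphisms if every object $A$ admits an inflation $A\to E$ that is an injective morphism, and enough projective morphisms if every object $A$ admits a deflation $P\to A$ that is a projective morphism. A special $\mathcal I$-precover of an object $A$ is a morphism $i_1:C_1\to A$ in $\mathcal I$ occurring as the deflation of a conflation $K_1\to C_1\to A$ that is the pushout of a conflation $K_0\to C_0\to A$ along some $k:K_0\to K_1$ in $\mathcal I^{\perp}$. A special $\mathcal J$-preenvelope of $B$ is a morphism $j_1:B\to C_1$ in $\mathcal J$ occurring as the inflation of a conflation $B\to C_1\to K_1$ that is the pullback of a conflation $B\to C_0\to K_0$ along some $k:K_1\to K_0$ in ${}^{\perp}\mathcal J$. An ideal $\mathcal I$ is special precovering (resp. special preenveloping) if every object has a special $\mathcal I$-precover (resp. special $\mathcal I$-preenvelope). Statement. Suppose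 that $(\mathcal A;\mathcal E)$ has enough injective morphisms and enough projective morphisms. Then $\mathcal I\mapsto\mathcal I^{\perp}$ is a bijection from the class of special precovering ideals of $(\mathcal A;\mathcal E)$ onto the class of its special preenveloping ideals, and its inverse is $\mathcal J\mapsto{}^{\perp}\mathcal J$. -/

import Mathlib

open CategoryTheory CategoryTheory.Limits

universe v u

namespace IdealApprox

variable {C : Type u} [Category.{v} C]

/-- A class of morphisms is an ideal when its members with given source and target form a subgroup
of the group of morphisms, and it absorbs composition with arbitrary morphisms on both sides. -/
structure IsIdeal [Preadditive C] (I : MorphismProperty C) : Prop where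
  zero_mem : ∀ X Y : C, I (0 : X ⟶ Y)
  add_mem : ∀ {X Y : C} {f g : X ⟶ Y}, I f → I g → I (f + g)
  neg_mem : ∀ {X Y : C} {f : X ⟶ Y}, I f → I (-f)
  precomp_mem : ∀ {X Y Z : C} (h : X ⟶ Y) {f : Y ⟶ Z}, I f → I (h ≫ f)
  postcomp_mem : ∀ {X Y Z : C} {f : X ⟶ Y} (h : Y ⟶ Z), I f → I (f ≫ h)

/-- `m` is the first map of some member of the given class of short complexes. -/
def IsInflationOf [HasZeroMorphisms C] (conf : ObjectProperty (ShortComplex C)) {A B : C}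
    (m : A ⟶ B) : Prop :=
  ∃ (D : C) (e : B ⟶ D) (w : m ≫ e = 0), conf (ShortComplex.mk m e w)

/-- `e` is the second map of some member of the given class of short complexes. -/
def IsDeflationOf [HasZeroMorphisms C] (conf : ObjectProperty (ShortComplex C)) {B D : C}
    (e : B ⟶ D) : Prop :=
  ∃ (A : C) (m : A ⟶ B) (w : m ≫ e = 0), conf (ShortComplex.mk m e w)

/-- An exact structure in the sense of Quillen on an additive category: a class of kernel-cokernel
pairs `A ⟶ B ⟶ D`, called conflations, closed under isomorphism and subject to the axioms
E₀, E₀ᵒᵖ, E₁, E₁ᵒᵖ, E₂, E₂ᵒᵖ. -/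
structure ExactStructure (C : Type u) [Category.{v} C] [Preadditive C]
    [HasFiniteBiproducts C] where
  /-- the class of conflations -/
  conflation : ObjectProperty (ShortComplex C)
  isoClosed : conflation.IsClosedUnderIsomorphisms
  isKernel : ∀ S : ShortComplex C, conflation S → Nonempty (IsLimit (KernelFork.ofι S.f S.zero))
  isCokernel : ∀ S : ShortComplex C, conflation S →
    Nonempty (IsColimit (CokernelCofork.ofπ S.g S.zero))
  id_inflation : ∀ A : C, IsInflationOf conflation (𝟙 A)
  id_deflation : ∀ A : C, IsDeflationOf conflation (𝟙 A)
  comp_inflation : ∀ {X Y Z : C} (f : X ⟶ Y) (g : Y ⟶ Z),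
    IsInflationOf conflation f → IsInflationOf conflation g → IsInflationOf conflation (f ≫ g)
  comp_deflation : ∀ {X Y Z : C} (f : X ⟶ Y) (g : Y ⟶ Z),
    IsDeflationOf conflation f → IsDeflationOf conflation g → IsDeflationOf conflation (f ≫ g)
  pushout_inflation : ∀ {A B A' : C} (m : A ⟶ B) (f : A ⟶ A'), IsInflationOf conflation m →
    ∃ (B' : C) (f' : B ⟶ B') (m' : A' ⟶ B'), IsPushout m f f' m' ∧ IsInflationOf conflation m'
  pullback_deflation : ∀ {B D D' : C} (e : B ⟶ D) (g : D' ⟶ D), IsDeflationOf conflation e →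
    ∃ (B' : C) (g' : B' ⟶ B) (e' : B' ⟶ D'), IsPullback g' e' e g ∧ IsDeflationOf conflation e'

namespace ExactStructure

variable [Preadditive C] [HasFiniteBiproducts C] (E : ExactStructure C)

/-- `m` is an inflation of the exact structure. -/
def IsInflation {A B : C} (m : A ⟶ B) : Prop := IsInflationOf E.conflation m

/-- `e` is a deflation of the exact structure. -/
def IsDeflation {B D : C} (e : B ⟶ D) : Prop := IsDeflationOf E.conflation e

/-- A mono-epi (ME) extension `i ⟶ a ⟶ j` of the arrow `j` by the arrow `i`: a morphism
`(i, a, j)` between two conflations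
```
  I₀ --m₀--> A₀ --e₀--> J₀
  |i         |a         |j
  I₁ --m₁--> A₁ --e₁--> J₁
```
that factors as `(i, a, j) = (i, b₂, 1) ∘ (1, b₁, j)` through a conflation `I₀ --m--> A --e--> J₁`.
-/
structure MEExtension {I₀ I₁ J₀ J₁ : C} (i : I₀ ⟶ I₁) (j : J₀ ⟶ J₁) where
  /-- source of the middle arrow -/
  A₀ : C
  /-- target of the middle arrow -/
  A₁ : C
  /-- the middle arrow -/
  a : A₀ ⟶ A₁
  /-- inflation of the first row -/
  m₀ : I₀ ⟶ A₀
  /-- deflation of the first row -/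
  e₀ : A₀ ⟶ J₀
  /-- inflation of the second row -/
  m₁ : I₁ ⟶ A₁
  /-- deflation of the second row -/
  e₁ : A₁ ⟶ J₁
  zero₀ : m₀ ≫ e₀ = 0
  zero₁ : m₁ ≫ e₁ = 0
  conflation₀ : E.conflation (ShortComplex.mk m₀ e₀ zero₀)
  conflation₁ : E.conflation (ShortComplex.mk m₁ e₁ zero₁)
  comm_left : m₀ ≫ a = i ≫ m₁
  comm_right : a ≫ e₁ = e₀ ≫ j
  monoEpi : ∃ (A : C) (m : I₀ ⟶ A) (e : A ⟶ J₁) (w : m ≫ e = 0) (b₁ : A₀ ⟶ A) (b₂ : A ⟶ A₁),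
    E.conflation (ShortComplex.mk m e w) ∧
    a = b₁ ≫ b₂ ∧
    m₀ ≫ b₁ = m ∧ b₁ ≫ e = e₀ ≫ j ∧
    m ≫ b₂ = i ≫ m₁ ∧ b₂ ≫ e₁ = e

/-- The extension is null-homotopic. -/
def MEExtension.NullHomotopic {E : ExactStructure C} {I₀ I₁ J₀ J₁ : C} {i : I₀ ⟶ I₁}
    {j : J₀ ⟶ J₁} (ξ : E.MEExtension i j) : Prop :=
  ∃ (h : ξ.A₀ ⟶ I₁) (g : J₀ ⟶ ξ.A₁), ξ.a = h ≫ ξ.m₁ + ξ.e₀ ≫ g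

/-- `Ext (j, i) = 0`: every ME-extension of `j` by `i` is null-homotopic. -/
def ExtOrthogonal {J₀ J₁ I₀ I₁ : C} (j : J₀ ⟶ J₁) (i : I₀ ⟶ I₁) : Prop :=
  ∀ ξ : E.MEExtension i j, ξ.NullHomotopic

/-- The right Ext-perpendicular class `I^⊥`. -/
def rightPerp (I : MorphismProperty C) : MorphismProperty C :=
  fun _ _ j => ∀ ⦃X Y : C⦄ (i : X ⟶ Y), I i → E.ExtOrthogonal i j

/-- The left Ext-perpendicular class `^⊥J`. -/
def leftPerp (J : MorphismProperty C) : MorphismProperty C :=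
  fun _ _ i => ∀ ⦃X Y : C⦄ (j : X ⟶ Y), J j → E.ExtOrthogonal i j

/-- Injective morphisms: those in `Hom^⊥`. -/
def InjectiveMorphism : MorphismProperty C := E.rightPerp ⊤

/-- Projective morphisms: those in `^⊥Hom`. -/
def ProjectiveMorphism : MorphismProperty C := E.leftPerp ⊤

/-- Every object is the source of an injective inflation. -/
def EnoughInjectiveMorphisms : Prop :=
  ∀ A : C, ∃ (X : C) (e : A ⟶ X), E.IsInflation e ∧ E.InjectiveMorphism e

/-- Every object is the target of a projective deflation. -/
def EnoughProjectiveMorphisms : Prop :=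
  ∀ A : C, ∃ (P : C) (p : P ⟶ A), E.IsDeflation p ∧ E.ProjectiveMorphism p

/-- `i₁ : C₁ ⟶ A` is a special `I`-precover of `A`: it lies in `I` and is the deflation of a
conflation `K₁ ⟶ C₁ ⟶ A` that is the pushout of a conflation `K₀ ⟶ C₀ ⟶ A` along a morphism
`k : K₀ ⟶ K₁` in `I^⊥`. -/
def IsSpecialPrecover (I : MorphismProperty C) {C₁ A : C} (i₁ : C₁ ⟶ A) : Prop :=
  I i₁ ∧
  ∃ (K₀ C₀ K₁ : C) (m₀ : K₀ ⟶ C₀) (e₀ : C₀ ⟶ A) (w₀ : m₀ ≫ e₀ = 0)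
    (m₁ : K₁ ⟶ C₁) (w₁ : m₁ ≫ i₁ = 0) (k : K₀ ⟶ K₁) (c : C₀ ⟶ C₁),
    E.conflation (ShortComplex.mk m₀ e₀ w₀) ∧
    E.conflation (ShortComplex.mk m₁ i₁ w₁) ∧
    E.rightPerp I k ∧
    IsPushout m₀ k c m₁ ∧
    c ≫ i₁ = e₀

/-- `j₁ : B ⟶ C₁` is a special `J`-preenvelope of `B`: it lies in `J` and is the inflation of a
conflation `B ⟶ C₁ ⟶ K₁` that is the pullback of a conflation `B ⟶ C₀ ⟶ K₀` along a morphism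
`k : K₁ ⟶ K₀` in `^⊥J`. -/
def IsSpecialPreenvelope (J : MorphismProperty C) {B C₁ : C} (j₁ : B ⟶ C₁) : Prop :=
  J j₁ ∧
  ∃ (K₀ C₀ K₁ : C) (m₀ : B ⟶ C₀) (e₀ : C₀ ⟶ K₀) (w₀ : m₀ ≫ e₀ = 0)
    (e₁ : C₁ ⟶ K₁) (w₁ : j₁ ≫ e₁ = 0) (k : K₁ ⟶ K₀) (c : C₁ ⟶ C₀),
    E.conflation (ShortComplex.mk m₀ e₀ w₀) ∧
    E.conflation (ShortComplex.mk j₁ e₁ w₁) ∧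
    E.leftPerp J k ∧
    IsPullback c e₁ e₀ k ∧
    j₁ ≫ c = m₀

/-- `I` is an ideal for which every object has a special `I`-precover. -/
def IsSpecialPrecoveringIdeal (I : MorphismProperty C) : Prop :=
  IsIdeal I ∧ ∀ A : C, ∃ (C₁ : C) (i₁ : C₁ ⟶ A), E.IsSpecialPrecover I i₁

/-- `J` is an ideal for which every object has a special `J`-preenvelope. -/
def IsSpecialPreenvelopingIdeal (J : MorphismProperty C) : Prop :=
  IsIdeal J ∧ ∀ B : C, ∃ (C₁ : C) (j₁ : B ⟶ C₁), E.IsSpecialPreenvelope J j₁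

end ExactStructure

end IdealApprox

/-!
Write an ME-extension of `j : J₀ ⟶ J₁` by `i : I₀ ⟶ I₁` as a conflation `I₀ ⟶ A ⟶ J₁`, pulled back
along `j` and pushed out along `i`. It is null-homotopic exactly when `i` extends along the
inflation of the pullback, and exactly when `j` lifts along the deflation of the pushout
(`extOrthogonal_iff_extend`, `extOrthogonal_iff_lift`). These two descriptions are dual to each
other; they show that `I^⊥` and `^⊥J` are always ideals, and that a morphism `g : X ⟶ A` of
`^⊥(I^⊥)` lifts along any special `I`-precover of `A`, whence `I = ^⊥(I^⊥)` when `I` is a special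
precovering ideal.

For the existence of special preenvelopes, choose a conflation `B --e--> X --p--> A` with `e`
injective, and a special `I`-precover `i₁ : C₁ ⟶ A`. The pullback of the conflation along `i₁` is
a conflation `B --j--> X ×_A C₁ ⟶ C₁`, and the only point is that `j = (e, 0)` is in `I^⊥`. Let
`B ⟶ F' ⟶ I₀` be the pullback of `B ⟶ F ⟶ I₁` along `i : I₀ ⟶ I₁` in `I`. As `e` is injective it
extends to `h : F ⟶ X`, and `h ≫ p` induces `u : I₁ ⟶ A`. The morphism `i ≫ u` of `I` lifts to
`v : I₀ ⟶ C₁`, and the pair `(F' ⟶ F ⟶ X, F' ⟶ I₀ ⟶ C₁)` extends `j` to `F'`. The other half is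
dual.
-/

namespace IdealApprox

namespace ExactStructure

variable {C : Type u} [Category.{v} C] [Preadditive C] [HasFiniteBiproducts C]
  (E : ExactStructure C)

variable {E} in
lemma mono_of_conflation {X Y Z : C} {m : X ⟶ Y} {e : Y ⟶ Z} {w : m ≫ e = 0}
    (h : E.conflation (ShortComplex.mk m e w)) : Mono m := by
  obtain ⟨hl⟩ := E.isKernel _ h
  exact ⟨fun f g hfg => Fork.IsLimit.hom_ext hl hfg⟩

variable {E} in
lemma epi_of_conflation {X Y Z : C} {m : X ⟶ Y} {e : Y ⟶ Z} {w : m ≫ e = 0}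
    (h : E.conflation (ShortComplex.mk m e w)) : Epi e := by
  obtain ⟨hl⟩ := E.isCokernel _ h
  exact ⟨fun f g hfg => Cofork.IsColimit.hom_ext hl hfg⟩

variable {E} in
lemma exists_lift_of_conflation {X Y Z W : C} {m : X ⟶ Y} {e : Y ⟶ Z} {w : m ≫ e = 0}
    (h : E.conflation (ShortComplex.mk m e w)) (f : W ⟶ Y) (hf : f ≫ e = 0) :
    ∃ g : W ⟶ X, g ≫ m = f := by
  obtain ⟨hl⟩ := E.isKernel _ h
  exact ⟨_, (KernelFork.IsLimit.lift' hl f hf).2⟩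

variable {E} in
lemma exists_desc_of_conflation {X Y Z W : C} {m : X ⟶ Y} {e : Y ⟶ Z} {w : m ≫ e = 0}
    (h : E.conflation (ShortComplex.mk m e w)) (f : Y ⟶ W) (hf : m ≫ f = 0) :
    ∃ g : Z ⟶ W, e ≫ g = f := by
  obtain ⟨hl⟩ := E.isCokernel _ h
  exact ⟨_, (CokernelCofork.IsColimit.desc' hl f hf).2⟩

/-! ### Pushouts and pullbacks of conflations -/

/-- The pushout of a conflation along a morphism out of its kernel, with the same cokernel. -/
lemma exists_pushout_conflation {X Y Z X' : C} {m : X ⟶ Y} {e : Y ⟶ Z} {w : m ≫ e = 0}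
    (h : E.conflation (ShortComplex.mk m e w)) (f : X ⟶ X') :
    ∃ (Y' : C) (f' : Y ⟶ Y') (m' : X' ⟶ Y') (e' : Y' ⟶ Z) (w' : m' ≫ e' = 0),
      IsPushout m f f' m' ∧ E.conflation (ShortComplex.mk m' e' w') ∧ f' ≫ e' = e := by
  obtain ⟨Y', f', m', hp, Z', e'', w'', h'⟩ := E.pushout_inflation m f ⟨Z, e, w, h⟩
  obtain ⟨e', he, w'⟩ : ∃ e' : Y' ⟶ Z, f' ≫ e' = e ∧ m' ≫ e' = 0 :=
    ⟨hp.desc e 0 (by simp [w]), by simp, by simp⟩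
  -- both `e'` and `e''` are cokernels of `m'`, so their targets are isomorphic
  obtain ⟨s, hs⟩ := exists_desc_of_conflation h' e' w'
  obtain ⟨t, ht⟩ := exists_desc_of_conflation h (f' ≫ e'')
    (by rw [← Category.assoc, hp.w, Category.assoc, w'', comp_zero])
  have ht' : e' ≫ t = e'' := by
    apply hp.hom_ext
    · rw [← Category.assoc, he, ht]
    · rw [← Category.assoc, w', w'', zero_comp]
  have hst : s ≫ t = 𝟙 _ := by
    have := epi_of_conflation h'
    rw [← cancel_epi e'', ← Category.assoc, hs, ht', Category.comp_id]
  have hts : t ≫ s = 𝟙 _ := by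
    have := epi_of_conflation h
    rw [← cancel_epi e, ← Category.assoc, ht, Category.assoc, hs, he, Category.comp_id]
  have := E.isoClosed
  let φ : ShortComplex.mk m' e'' w'' ≅ ShortComplex.mk m' e' w' :=
    ShortComplex.isoMk (Iso.refl _) (Iso.refl _) ⟨s, t, hst, hts⟩ (by simp) (by simp [hs])
  exact ⟨Y', f', m', e', w', hp, E.conflation.prop_of_iso φ h', he⟩

/-- The pullback of a conflation along a morphism into its cokernel, with the same kernel. -/
lemma exists_pullback_conflation {X Y Z Z' : C} {m : X ⟶ Y} {e : Y ⟶ Z} {w : m ≫ e = 0}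
    (h : E.conflation (ShortComplex.mk m e w)) (g : Z' ⟶ Z) :
    ∃ (Y' : C) (g' : Y' ⟶ Y) (m' : X ⟶ Y') (e' : Y' ⟶ Z') (w' : m' ≫ e' = 0),
      IsPullback g' e' e g ∧ E.conflation (ShortComplex.mk m' e' w') ∧ m' ≫ g' = m := by
  obtain ⟨Y', g', e', hp, X', m'', w'', h'⟩ := E.pullback_deflation e g ⟨X, m, w, h⟩
  obtain ⟨m', hm, w'⟩ : ∃ m' : X ⟶ Y', m' ≫ g' = m ∧ m' ≫ e' = 0 :=
    ⟨hp.lift m 0 (by simp [w]), by simp, by simp⟩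
  -- both `m'` and `m''` are kernels of `e'`, so their sources are isomorphic
  obtain ⟨s, hs⟩ := exists_lift_of_conflation h' m' w'
  obtain ⟨t, ht⟩ := exists_lift_of_conflation h (m'' ≫ g')
    (by rw [Category.assoc, hp.w, ← Category.assoc, w'', zero_comp])
  have ht' : t ≫ m' = m'' := by
    apply hp.hom_ext
    · rw [Category.assoc, hm, ht]
    · rw [Category.assoc, w', w'', comp_zero]
  have hst : s ≫ t = 𝟙 _ := by
    have := mono_of_conflation h
    rw [← cancel_mono m, Category.assoc, ht, ← Category.assoc, hs, hm, Category.id_comp]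
  have hts : t ≫ s = 𝟙 _ := by
    have := mono_of_conflation h'
    rw [← cancel_mono m'', Category.assoc, hs, ht', Category.id_comp]
  have := E.isoClosed
  let φ : ShortComplex.mk m'' e' w'' ≅ ShortComplex.mk m' e' w' :=
    ShortComplex.isoMk ⟨t, s, hts, hst⟩ (Iso.refl _) (Iso.refl _) (by simp [ht']) (by simp)
  exact ⟨Y', g', m', e', w', hp, E.conflation.prop_of_iso φ h', hm⟩

/-! ### Ext-orthogonality as an extension and as a lifting property -/

/-- `Ext (j, i) = 0` when `i` extends along the inflation of every conflation that is the pullback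
along `j` of a conflation from the source of `i` to the target of `j`. -/
lemma extOrthogonal_iff_extend {I₀ I₁ J₀ J₁ : C} (j : J₀ ⟶ J₁) (i : I₀ ⟶ I₁) :
    E.ExtOrthogonal j i ↔ ∀ ⦃A₀ A : C⦄ (m₀ : I₀ ⟶ A₀) (e₀ : A₀ ⟶ J₀) (w₀ : m₀ ≫ e₀ = 0)
      (m : I₀ ⟶ A) (e : A ⟶ J₁) (w : m ≫ e = 0) (b : A₀ ⟶ A),
      E.conflation (ShortComplex.mk m₀ e₀ w₀) → E.conflation (ShortComplex.mk m e w) →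
      m₀ ≫ b = m → b ≫ e = e₀ ≫ j → ∃ h : A₀ ⟶ I₁, m₀ ≫ h = i := by
  constructor
  · intro H A₀ A m₀ e₀ w₀ m e w b h₀ hm hb₁ hb₂
    obtain ⟨A₁, f, m₁, e₁, w₁, hp, h₁, hf⟩ := E.exists_pushout_conflation hm i
    obtain ⟨h, g, hg⟩ := H
      { A₀ := A₀, A₁ := A₁, a := b ≫ f, m₀ := m₀, e₀ := e₀, m₁ := m₁, e₁ := e₁
        zero₀ := w₀, zero₁ := w₁, conflation₀ := h₀, conflation₁ := h₁
        comm_left := by rw [← Category.assoc, hb₁, hp.w]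
        comm_right := by rw [Category.assoc, hf, hb₂]
        monoEpi := ⟨A, m, e, w, b, f, hm, rfl, hb₁, hb₂, hp.w, hf⟩ }
    dsimp only at h g hg
    refine ⟨h, ?_⟩
    have := mono_of_conflation h₁
    rw [← cancel_mono m₁, ← hp.w, ← hb₁, Category.assoc m₀ b f, hg, Preadditive.comp_add,
      ← Category.assoc m₀ e₀ g, w₀, zero_comp, add_zero, Category.assoc]
  · intro H ξ
    obtain ⟨A, m, e, w, b₁, b₂, hm, -, h₁, h₂, -, -⟩ := ξ.monoEpi
    obtain ⟨h, hh⟩ := H ξ.m₀ ξ.e₀ ξ.zero₀ m e w b₁ ξ.conflation₀ hm h₁ h₂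
    obtain ⟨g, hg⟩ := exists_desc_of_conflation ξ.conflation₀ (ξ.a - h ≫ ξ.m₁)
      (by rw [Preadditive.comp_sub, ξ.comm_left, ← Category.assoc, hh, sub_self])
    exact ⟨h, g, by rw [hg, add_sub_cancel]⟩

/-- `Ext (j, i) = 0` when `j` lifts along the deflation of every conflation that is the pushout
along `i` of a conflation from the source of `i` to the target of `j`. -/
lemma extOrthogonal_iff_lift {I₀ I₁ J₀ J₁ : C} (j : J₀ ⟶ J₁) (i : I₀ ⟶ I₁) :
    E.ExtOrthogonal j i ↔ ∀ ⦃A A₁ : C⦄ (m : I₀ ⟶ A) (e : A ⟶ J₁) (w : m ≫ e = 0)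
      (m₁ : I₁ ⟶ A₁) (e₁ : A₁ ⟶ J₁) (w₁ : m₁ ≫ e₁ = 0) (b : A ⟶ A₁),
      E.conflation (ShortComplex.mk m e w) → E.conflation (ShortComplex.mk m₁ e₁ w₁) →
      m ≫ b = i ≫ m₁ → b ≫ e₁ = e → ∃ g : J₀ ⟶ A₁, g ≫ e₁ = j := by
  constructor
  · intro H A A₁ m e w m₁ e₁ w₁ b hm h₁ hb₁ hb₂
    obtain ⟨A₀, f, m₀, e₀, w₀, hp, h₀, hf⟩ := E.exists_pullback_conflation hm j
    obtain ⟨h, g, hg⟩ := H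
      { A₀ := A₀, A₁ := A₁, a := f ≫ b, m₀ := m₀, e₀ := e₀, m₁ := m₁, e₁ := e₁
        zero₀ := w₀, zero₁ := w₁, conflation₀ := h₀, conflation₁ := h₁
        comm_left := by rw [← Category.assoc, hf, hb₁]
        comm_right := by rw [Category.assoc, hb₂, hp.w]
        monoEpi := ⟨A, m, e, w, f, b, hm, rfl, hf, hp.w, hb₁, hb₂⟩ }
    dsimp only at h g hg
    refine ⟨g, ?_⟩
    have := epi_of_conflation h₀
    rw [← cancel_epi e₀, ← hp.w, ← hb₂, ← Category.assoc f b e₁, hg, Preadditive.add_comp,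
      Category.assoc h m₁ e₁, w₁, comp_zero, zero_add, Category.assoc]
  · intro H ξ
    obtain ⟨A, m, e, w, b₁, b₂, hm, -, -, -, h₁, h₂⟩ := ξ.monoEpi
    obtain ⟨g, hg⟩ := H m e w ξ.m₁ ξ.e₁ ξ.zero₁ b₂ hm ξ.conflation₁ h₁ h₂
    obtain ⟨h, hh⟩ := exists_lift_of_conflation ξ.conflation₁ (ξ.a - ξ.e₀ ≫ g)
      (by rw [Preadditive.sub_comp, ξ.comm_right, Category.assoc, hg, sub_self])
    exact ⟨h, g, by rw [hh, sub_add_cancel]⟩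

/-! ### Perpendicular classes are ideals -/

lemma isIdeal_rightPerp (I : MorphismProperty C) : IsIdeal (E.rightPerp I) where
  zero_mem X Y _ _ i _ := (E.extOrthogonal_iff_extend _ _).2
    fun _ _ _ _ _ _ _ _ _ _ _ _ _ => ⟨0, comp_zero⟩
  add_mem hf hg _ _ i hi := (E.extOrthogonal_iff_extend _ _).2
    fun _ _ m₀ e₀ w₀ m e w b h₀ h hb₁ hb₂ => by
      obtain ⟨s, hs⟩ := (E.extOrthogonal_iff_extend _ _).1 (hf i hi) m₀ e₀ w₀ m e w b h₀ h hb₁ hb₂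
      obtain ⟨t, ht⟩ := (E.extOrthogonal_iff_extend _ _).1 (hg i hi) m₀ e₀ w₀ m e w b h₀ h hb₁ hb₂
      exact ⟨s + t, by rw [Preadditive.comp_add, hs, ht]⟩
  neg_mem hf _ _ i hi := (E.extOrthogonal_iff_extend _ _).2
    fun _ _ m₀ e₀ w₀ m e w b h₀ h hb₁ hb₂ => by
      obtain ⟨s, hs⟩ := (E.extOrthogonal_iff_extend _ _).1 (hf i hi) m₀ e₀ w₀ m e w b h₀ h hb₁ hb₂
      exact ⟨-s, by rw [Preadditive.comp_neg, hs]⟩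
  postcomp_mem r hf _ _ i hi := (E.extOrthogonal_iff_extend _ _).2
    fun _ _ m₀ e₀ w₀ m e w b h₀ h hb₁ hb₂ => by
      obtain ⟨s, hs⟩ := (E.extOrthogonal_iff_extend _ _).1 (hf i hi) m₀ e₀ w₀ m e w b h₀ h hb₁ hb₂
      exact ⟨s ≫ r, by rw [← Category.assoc, hs]⟩
  precomp_mem r f hf _ _ i hi := (E.extOrthogonal_iff_lift _ _).2
    fun _ _ m e w m₁ e₁ w₁ b h h₁ hb₁ hb₂ => by
      -- a pushout along `r ≫ f` is a pushout along `f` of the pushout along `r`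
      obtain ⟨A', r', m', e', w', hp, h', hr⟩ := E.exists_pushout_conflation h r
      refine (E.extOrthogonal_iff_lift _ _).1 (hf i hi) m' e' w' m₁ e₁ w₁
        (hp.desc b (f ≫ m₁) (by rw [hb₁, Category.assoc])) h' h₁ (hp.inr_desc _ _ _) ?_
      apply hp.hom_ext
      · rw [hp.inl_desc_assoc, hb₂, hr]
      · rw [hp.inr_desc_assoc, Category.assoc, w₁, w', comp_zero]

lemma isIdeal_leftPerp (J : MorphismProperty C) : IsIdeal (E.leftPerp J) where
  zero_mem X Y _ _ j _ := (E.extOrthogonal_iff_lift _ _).2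
    fun _ _ _ _ _ _ _ _ _ _ _ _ _ => ⟨0, zero_comp⟩
  add_mem hf hg _ _ j hj := (E.extOrthogonal_iff_lift _ _).2
    fun _ _ m e w m₁ e₁ w₁ b h h₁ hb₁ hb₂ => by
      obtain ⟨s, hs⟩ := (E.extOrthogonal_iff_lift _ _).1 (hf j hj) m e w m₁ e₁ w₁ b h h₁ hb₁ hb₂
      obtain ⟨t, ht⟩ := (E.extOrthogonal_iff_lift _ _).1 (hg j hj) m e w m₁ e₁ w₁ b h h₁ hb₁ hb₂
      exact ⟨s + t, by rw [Preadditive.add_comp, hs, ht]⟩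
  neg_mem hf _ _ j hj := (E.extOrthogonal_iff_lift _ _).2
    fun _ _ m e w m₁ e₁ w₁ b h h₁ hb₁ hb₂ => by
      obtain ⟨s, hs⟩ := (E.extOrthogonal_iff_lift _ _).1 (hf j hj) m e w m₁ e₁ w₁ b h h₁ hb₁ hb₂
      exact ⟨-s, by rw [Preadditive.neg_comp, hs]⟩
  precomp_mem r f hf _ _ j hj := (E.extOrthogonal_iff_lift _ _).2
    fun _ _ m e w m₁ e₁ w₁ b h h₁ hb₁ hb₂ => by
      obtain ⟨s, hs⟩ := (E.extOrthogonal_iff_lift _ _).1 (hf j hj) m e w m₁ e₁ w₁ b h h₁ hb₁ hb₂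
      exact ⟨r ≫ s, by rw [Category.assoc, hs]⟩
  postcomp_mem {_ _ _ f} r hf _ _ j hj := (E.extOrthogonal_iff_extend _ _).2
    fun _ _ m₀ e₀ w₀ m e w b h₀ h hb₁ hb₂ => by
      -- a pullback along `f ≫ r` is a pullback along `f` of the pullback along `r`
      obtain ⟨A', r', m', e', w', hp, h', hr⟩ := E.exists_pullback_conflation h r
      refine (E.extOrthogonal_iff_extend _ _).1 (hf j hj) m₀ e₀ w₀ m' e' w'
        (hp.lift b (e₀ ≫ f) (by rw [hb₂, Category.assoc])) h₀ h' ?_ (hp.lift_snd _ _ _)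
      apply hp.hom_ext
      · rw [Category.assoc, hp.lift_fst, hb₁, hr]
      · rw [Category.assoc, hp.lift_snd, ← Category.assoc, w₀, w', zero_comp]

/-! ### Special precovers and special preenvelopes -/

variable {E} in
/-- A special `I`-precover is a precover for the possibly larger class `^⊥(I^⊥)`. -/
lemma IsSpecialPrecover.exists_lift {I : MorphismProperty C} {C₁ A : C} {i₁ : C₁ ⟶ A}
    (h : E.IsSpecialPrecover I i₁) {X : C} (g : X ⟶ A) (hg : E.leftPerp (E.rightPerp I) g) :
    ∃ f : X ⟶ C₁, f ≫ i₁ = g := by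
  obtain ⟨-, K₀, C₀, K₁, m₀, e₀, w₀, m₁, w₁, k, c, h₀, h₁, hk, hp, hc⟩ := h
  exact (E.extOrthogonal_iff_lift g k).1 (hg k hk) m₀ e₀ w₀ m₁ i₁ w₁ c h₀ h₁ hp.w hc

variable {E} in
/-- A special `J`-preenvelope is a preenvelope for the possibly larger class `(^⊥J)^⊥`. -/
lemma IsSpecialPreenvelope.exists_extend {J : MorphismProperty C} {B C₁ : C} {j₁ : B ⟶ C₁}
    (h : E.IsSpecialPreenvelope J j₁) {X : C} (g : B ⟶ X)
    (hg : E.rightPerp (E.leftPerp J) g) : ∃ f : C₁ ⟶ X, j₁ ≫ f = g := by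
  obtain ⟨-, K₀, C₀, K₁, m₀, e₀, w₀, e₁, w₁, k, c, h₀, h₁, hk, hp, hc⟩ := h
  exact (E.extOrthogonal_iff_extend k g).1 (hg k hk) j₁ e₁ w₁ m₀ e₀ w₀ c h₁ h₀ hc hp.w

lemma le_leftPerp_rightPerp (I : MorphismProperty C) : I ≤ E.leftPerp (E.rightPerp I) :=
  fun _ _ i hi _ _ _ hj => hj i hi

lemma le_rightPerp_leftPerp (J : MorphismProperty C) : J ≤ E.rightPerp (E.leftPerp J) :=
  fun _ _ j hj _ _ _ hi => hi j hj

variable {E} in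
lemma IsSpecialPrecoveringIdeal.leftPerp_rightPerp {I : MorphismProperty C}
    (h : E.IsSpecialPrecoveringIdeal I) : E.leftPerp (E.rightPerp I) = I := by
  refine le_antisymm (fun X A g hg => ?_) (E.le_leftPerp_rightPerp I)
  obtain ⟨C₁, i₁, hi₁⟩ := h.2 A
  obtain ⟨f, rfl⟩ := hi₁.exists_lift g hg
  exact h.1.precomp_mem f hi₁.1

variable {E} in
lemma IsSpecialPreenvelopingIdeal.rightPerp_leftPerp {J : MorphismProperty C}
    (h : E.IsSpecialPreenvelopingIdeal J) : E.rightPerp (E.leftPerp J) = J := by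
  refine le_antisymm (fun B X g hg => ?_) (E.le_rightPerp_leftPerp J)
  obtain ⟨C₁, j₁, hj₁⟩ := h.2 B
  obtain ⟨f, rfl⟩ := hj₁.exists_extend g hg
  exact h.1.postcomp_mem f hj₁.1

variable {E} in
lemma InjectiveMorphism.exists_extend {X Y F D : C} {f : X ⟶ Y} (hf : E.InjectiveMorphism f)
    {m : X ⟶ F} {e : F ⟶ D} {w : m ≫ e = 0} (h : E.conflation (ShortComplex.mk m e w)) :
    ∃ g : F ⟶ Y, m ≫ g = f :=
  (E.extOrthogonal_iff_extend (𝟙 D) f).1 (hf (𝟙 D) trivial) m e w m e w (𝟙 F) h h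
    (Category.comp_id _) (by rw [Category.id_comp, Category.comp_id])

variable {E} in
lemma ProjectiveMorphism.exists_lift {X Y F K : C} {f : X ⟶ Y} (hf : E.ProjectiveMorphism f)
    {m : K ⟶ F} {e : F ⟶ Y} {w : m ≫ e = 0} (h : E.conflation (ShortComplex.mk m e w)) :
    ∃ g : X ⟶ F, g ≫ e = f :=
  (E.extOrthogonal_iff_lift f (𝟙 K)).1 (hf (𝟙 K) trivial) m e w m e w (𝟙 F) h h
    (by rw [Category.id_comp, Category.comp_id]) (Category.id_comp _)

variable {E} in
/-- The special preenvelope of `B` is the pullback of an injective inflation `B ⟶ X` along a special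
precover of its cokernel. -/
lemma IsSpecialPrecoveringIdeal.rightPerp {I : MorphismProperty C}
    (hI : E.IsSpecialPrecoveringIdeal I) (hinj : E.EnoughInjectiveMorphisms) :
    E.IsSpecialPreenvelopingIdeal (E.rightPerp I) := by
  refine ⟨E.isIdeal_rightPerp I, fun B => ?_⟩
  obtain ⟨X, e, ⟨A, p, w, hc⟩, he⟩ := hinj B
  obtain ⟨C₁, i₁, hi₁⟩ := hI.2 A
  obtain ⟨D, d, j, q, wj, hp, hj, hd⟩ := E.exists_pullback_conflation hc i₁
  refine ⟨D, j, fun I₀ I₁ i hi => (E.extOrthogonal_iff_extend i j).2 ?_, A, X, C₁, e, p, w, q, wj,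
    i₁, d, hc, hj, E.le_leftPerp_rightPerp I _ hi₁.1, hp, hd⟩
  intro F' F m' e' w' m f wf b h' hF hb₁ hb₂
  obtain ⟨h, hh⟩ := InjectiveMorphism.exists_extend he hF
  obtain ⟨u, hu⟩ := exists_desc_of_conflation hF (h ≫ p) (by rw [← Category.assoc, hh, w])
  -- `i` is in the ideal `I`, hence so is `i ≫ u`, which therefore lifts along the precover
  obtain ⟨v, hv⟩ := hi₁.exists_lift (i ≫ u)
    (E.le_leftPerp_rightPerp I _ (hI.1.postcomp_mem u hi))
  refine ⟨hp.lift (b ≫ h) (e' ≫ v) ?_, ?_⟩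
  · rw [Category.assoc, Category.assoc, hv, ← hu, ← Category.assoc b, hb₂, Category.assoc]
  · apply hp.hom_ext
    · rw [Category.assoc, hp.lift_fst, ← Category.assoc, hb₁, hh, hd]
    · rw [Category.assoc, hp.lift_snd, ← Category.assoc, w', wj, zero_comp]

variable {E} in
/-- The special precover of `A` is the pushout of a projective deflation `P ⟶ A` along a special
preenvelope of its kernel. -/
lemma IsSpecialPreenvelopingIdeal.leftPerp {J : MorphismProperty C}
    (hJ : E.IsSpecialPreenvelopingIdeal J) (hproj : E.EnoughProjectiveMorphisms) :
    E.IsSpecialPrecoveringIdeal (E.leftPerp J) := by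
  refine ⟨E.isIdeal_leftPerp J, fun A => ?_⟩
  obtain ⟨P, p, ⟨B, m, w, hc⟩, hpr⟩ := hproj A
  obtain ⟨C₁, j₁, hj₁⟩ := hJ.2 B
  obtain ⟨D, d, n, i, wi, hp, hi, hd⟩ := E.exists_pushout_conflation hc j₁
  refine ⟨D, i, fun J₀ J₁ j hj => (E.extOrthogonal_iff_lift i j).2 ?_, B, P, C₁, m, p, w, n, wi,
    j₁, d, hc, hi, E.le_rightPerp_leftPerp J _ hj₁.1, hp, hd⟩
  intro F F' f e wf m' e' w' b hF h' hb₁ hb₂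
  obtain ⟨h, hh⟩ := ProjectiveMorphism.exists_lift hpr hF
  obtain ⟨u, hu⟩ := exists_lift_of_conflation hF (m ≫ h) (by rw [Category.assoc, hh, w])
  -- `j` is in the ideal `J`, hence so is `u ≫ j`, which therefore extends along the preenvelope
  obtain ⟨v, hv⟩ := hj₁.exists_extend (u ≫ j)
    (E.le_rightPerp_leftPerp J _ (hJ.1.precomp_mem u hj))
  refine ⟨hp.desc (h ≫ b) (v ≫ m') ?_, ?_⟩
  · rw [← Category.assoc, ← Category.assoc, hv, ← hu, Category.assoc, Category.assoc, hb₁]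
  · apply hp.hom_ext
    · rw [hp.inl_desc_assoc, Category.assoc, hb₂, hh, hd]
    · rw [hp.inr_desc_assoc, Category.assoc, w', wi, comp_zero]

end ExactStructure

end IdealApprox

theorem mainTheorem7 {C : Type u} [Category.{v} C] [Preadditive C] [HasFiniteBiproducts C]
    (E : IdealApprox.ExactStructure C)
    (hinj : E.EnoughInjectiveMorphisms) (hproj : E.EnoughProjectiveMorphisms) :
    Set.BijOn E.rightPerp
      {I : MorphismProperty C | E.IsSpecialPrecoveringIdeal I}
      {J : MorphismProperty C | E.IsSpecialPreenvelopingIdeal J} ∧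
    Set.InvOn E.leftPerp E.rightPerp
      {I : MorphismProperty C | E.IsSpecialPrecoveringIdeal I}
      {J : MorphismProperty C | E.IsSpecialPreenvelopingIdeal J} := by
  have hinv : Set.InvOn E.leftPerp E.rightPerp
      {I : MorphismProperty C | E.IsSpecialPrecoveringIdeal I}
      {J : MorphismProperty C | E.IsSpecialPreenvelopingIdeal J} :=
    ⟨fun _ hI => hI.leftPerp_rightPerp, fun _ hJ => hJ.rightPerp_leftPerp⟩
  exact ⟨hinv.bijOn (fun _ hI => hI.rightPerp hinj) (fun _ hJ => hJ.leftPerp hproj), hinv⟩
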